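/- There is an absolute constant $C>0$ such that the following holds for all integers $0<r<d$. Let $B\in\mathbb{R}^{d\times r}$ be a random matrix whose entries are independent Gaussian random variables with mean $0$ and variance $1/r$, and let $\|B\|$ denote its operator norm with respect to the Euclidean norms. 1. (Bounded operator norm) $\|B\|^2$ is integrable and $$\mathbb{E}\,\|B\|^2\le\frac{d}{r}\left(1+C\sqrt{\frac{r}{d}}\right).$$ 2. (Unbiasedness) For every unit vector $\mathbf{v}\in\mathbb{R}^d$, the random vector $BB^\top\mathbf{v}$ is integrable and $\mathbb{E}\left[BB^\top\mathbf{v}\right]=\mathbf{v}$, i.e. $\left\|\mathbb{E}\left[BB^\top\mathbf{v}\right]-\mathbf{v}\right\|=0$. -/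

import Mathlib

-- `‖A‖` for a matrix `A` is the operator norm with respect to Euclidean norms.
open scoped Matrix.Norms.L2Operator
open scoped Matrix NNReal

/-! For a fixed unit vector `y`, the coordinates of `B y` are independent Gaussians of variance
`1/r`, so `‖B y‖ ^ 2` concentrates around `d/r` with sub-exponential tails
(`integrable_exp_and_mgf_le_mulVec`). Controlling this deviation on a net of `5 ^ r` points controls
the norm of `Bᵀ B - (d/r) I` (`Matrix.l2_opNorm_sq_le_of_half_net`). The expected maximum over the
net is at most the log of a summed exponential moment, of order `r + d t ^ 2`, divided by `t r`;
taking `t` of order `√(r/d)` gives an error of order `√(d/r)`. Unbiasedness is a second-moment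
computation on the entries. -/

/-! ### Nets and operator norms. -/

/-- The unit sphere of a finite-dimensional real normed space has a `1/2`-net of at most
`5 ^ dim` points. -/
theorem exists_half_net_sphere (E : Type*) [NormedAddCommGroup E] [NormedSpace ℝ E]
    [FiniteDimensional ℝ E] :
    ∃ N : Finset E, N.card ≤ 5 ^ Module.finrank ℝ E ∧ (∀ y ∈ N, ‖y‖ = 1) ∧
      ∀ x : E, ‖x‖ = 1 → ∃ y ∈ N, ‖x - y‖ ≤ 1 / 2 := by
  classical
  let P : Finset E → Prop := fun N => (∀ y ∈ N, ‖y‖ = 1) ∧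
    ∀ y ∈ N, ∀ z ∈ N, y ≠ z → 1 / 2 ≤ ‖y - z‖
  have hcard : ∀ N, P N → N.card ≤ 5 ^ Module.finrank ℝ E := by
    intro N hN
    -- Doubling turns `1/2`-separated unit vectors into `1`-separated points in the ball of radius
    -- `2`, the normalization of the Besicovitch packing bound.
    have hinj : Function.Injective fun y : E => (2 : ℝ) • y := smul_right_injective E two_ne_zero
    rw [← Finset.card_image_of_injective N hinj]
    apply Besicovitch.card_le_of_separated
    · intro c hc
      obtain ⟨y, hy, rfl⟩ := Finset.mem_image.1 hc
      simp [norm_smul, hN.1 y hy]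
    · intro c hc e he hce
      obtain ⟨y, hy, rfl⟩ := Finset.mem_image.1 hc
      obtain ⟨z, hz, rfl⟩ := Finset.mem_image.1 he
      have hyz : y ≠ z := fun h => hce (by rw [h])
      have := hN.2 y hy z hz hyz
      rw [← smul_sub, norm_smul, Real.norm_two]
      linarith
  -- A separated set of maximal cardinality is a net: an uncovered point could be added to it.
  obtain ⟨N, hN, hmax⟩ : ∃ N, P N ∧ ∀ M, P M → M.card ≤ N.card := by
    let S : Set ℕ := {n | ∃ N, P N ∧ N.card = n}
    have hne : S.Nonempty := ⟨0, ∅, ⟨by simp, by simp⟩, by simp⟩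
    have hbdd : BddAbove S := ⟨_, by rintro _ ⟨N, hN, rfl⟩; exact hcard N hN⟩
    obtain ⟨N, hN, hc⟩ := Nat.sSup_mem hne hbdd
    exact ⟨N, hN, fun M hM => hc ▸ le_csSup hbdd ⟨M, hM, rfl⟩⟩
  refine ⟨N, hcard N hN, hN.1, fun x hx => ?_⟩
  by_contra! hfar
  have hxN : x ∉ N := fun h => by have := hfar x h; norm_num at this
  have hP : P (insert x N) := by
    refine ⟨?_, ?_⟩
    · intro y hy
      rcases Finset.mem_insert.1 hy with rfl | hy
      exacts [hx, hN.1 y hy]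
    · intro y hy z hz hyz
      rcases Finset.mem_insert.1 hy with hy | hy <;> rcases Finset.mem_insert.1 hz with hz | hz
      · exact absurd (hy.trans hz.symm) hyz
      · rw [hy]; exact (hfar z hz).le
      · rw [hz, norm_sub_rev]; exact (hfar y hy).le
      · exact hN.2 y hy z hz hyz
  have := hmax _ hP
  rw [Finset.card_insert_of_notMem hxN] at this
  omega

open scoped RealInnerProductSpace in
/-- The norm of a symmetric operator is controlled by its quadratic form on a `1/2`-net of the
unit sphere. -/
theorem ContinuousLinearMap.norm_le_of_half_net {E : Type*} [NormedAddCommGroup E]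
    [InnerProductSpace ℝ E] (T : E →L[ℝ] E) (hT : T.IsSymmetric) (N : Finset E)
    (hN1 : ∀ y ∈ N, ‖y‖ = 1) (hN : ∀ x : E, ‖x‖ = 1 → ∃ y ∈ N, ‖x - y‖ ≤ 1 / 2)
    {c : ℝ} (hc0 : 0 ≤ c) (hc : ∀ y ∈ N, |⟪y, T y⟫| ≤ c) : ‖T‖ ≤ 32 * c := by
  have key : ∀ x : E, ‖x‖ = 1 → |⟪x, T x⟫| ≤ c + 31 / 32 * ‖T‖ := by
    intro x hx
    obtain ⟨y, hy, hxy⟩ := hN x hx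
    have hsymm : ⟪x, T y⟫ = ⟪y, T x⟫ := by
      rw [real_inner_comm]; exact hT y x
    have hdiff : ⟪x, T x⟫ - ⟪y, T y⟫ = ⟪x - y, T (x + y)⟫ := by
      rw [map_add, inner_sub_left, inner_add_right, inner_add_right, hsymm]; ring
    -- The triangle inequality gives only `1`, too weak to absorb `‖T‖` below. The parallelogram law
    -- bounds the square by `1/4 * 15/4 = 15/16 ≤ (31/32) ^ 2`.
    have hprod : ‖x - y‖ * ‖x + y‖ ≤ 31 / 32 := by
      have hpar := parallelogram_law_with_norm ℝ x y
      rw [hx, hN1 y hy] at hpar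
      have h0 := norm_nonneg (x - y)
      refine abs_le_of_sq_le_sq' ?_ (by norm_num) |>.2
      have ha : ‖x - y‖ ^ 2 ≤ 1 / 4 := by nlinarith
      have hb : ‖x + y‖ ^ 2 = 4 - ‖x - y‖ ^ 2 := by nlinarith
      rw [mul_pow, hb]
      nlinarith [sq_nonneg ‖x - y‖]
    have hb : |⟪x - y, T (x + y)⟫| ≤ 31 / 32 * ‖T‖ := calc
      _ ≤ ‖x - y‖ * ‖T (x + y)‖ := abs_real_inner_le_norm _ _
      _ ≤ ‖x - y‖ * (‖T‖ * ‖x + y‖) := by gcongr; exact T.le_opNorm _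
      _ = (‖x - y‖ * ‖x + y‖) * ‖T‖ := by ring
      _ ≤ _ := by gcongr
    calc |⟪x, T x⟫| = |⟪y, T y⟫ + ⟪x - y, T (x + y)⟫| := by rw [← hdiff]; congr 1; ring
      _ ≤ _ := abs_add_le _ _
      _ ≤ _ := add_le_add (hc y hy) hb
  have hle : ‖T‖ ≤ c + 31 / 32 * ‖T‖ := by
    conv_lhs => rw [T.norm_eq_iSup_rayleighQuotient hT]
    refine ciSup_le fun x => ?_
    by_cases hx : x = 0
    · simp only [hx, ContinuousLinearMap.rayleighQuotient_apply_zero, abs_zero]; positivity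
    · have hn : ‖x‖ ≠ 0 := norm_ne_zero_iff.2 hx
      have h1 : ‖(‖x‖⁻¹ : ℝ) • x‖ = 1 := by rw [norm_smul]; simp [hn]
      rw [← T.rayleigh_smul x (inv_ne_zero hn)]
      have := key _ h1
      rw [ContinuousLinearMap.rayleighQuotient, ContinuousLinearMap.reApplyInnerSelf_apply, h1,
        real_inner_comm]
      simpa using this
  linarith

/-- If the squared lengths of the images of a `1/2`-net under `B` are within `c` of `a`, then
`‖B‖ ^ 2 ≤ a + 32 * c`. -/
theorem Matrix.l2_opNorm_sq_le_of_half_net {d r : ℕ} (B : Matrix (Fin d) (Fin r) ℝ)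
    (N : Finset (EuclideanSpace ℝ (Fin r))) (hN1 : ∀ y ∈ N, ‖y‖ = 1)
    (hN : ∀ x : EuclideanSpace ℝ (Fin r), ‖x‖ = 1 → ∃ y ∈ N, ‖x - y‖ ≤ 1 / 2)
    {a c : ℝ} (ha : 0 ≤ a) (hc0 : 0 ≤ c)
    (hc : ∀ y ∈ N, |∑ i, (B *ᵥ y.ofLp) i ^ 2 - a| ≤ c) : ‖B‖ ^ 2 ≤ a + 32 * c := by
  set A : Matrix (Fin r) (Fin r) ℝ := Bᵀ * B - a • 1 with hA
  have hAsymm : A.IsHermitian := by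
    ext i j
    simp [hA, Matrix.mul_apply, Matrix.one_apply, mul_comm, eq_comm]
  have hT : (Matrix.toEuclideanCLM (n := Fin r) (𝕜 := ℝ) A).IsSymmetric := by
    apply ContinuousLinearMap.isSelfAdjoint_iff_isSymmetric.1
    exact (show IsSelfAdjoint A from hAsymm).map _
  have hbound : ‖A‖ ≤ 32 * c := by
    rw [Matrix.cstar_norm_def]
    refine ContinuousLinearMap.norm_le_of_half_net _ hT N hN1 hN hc0 fun y hy => ?_
    rw [Matrix.inner_toEuclideanCLM]
    convert hc y hy using 2
    have hy2 : y.ofLp ⬝ᵥ y.ofLp = 1 := by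
      have := EuclideanSpace.real_norm_sq_eq y
      rw [hN1 y hy] at this
      simp only [dotProduct, ← sq]
      simpa using this.symm
    rw [hA, Matrix.sub_mulVec, dotProduct_sub, Matrix.smul_mulVec, Matrix.one_mulVec,
      dotProduct_smul, hy2, ← Matrix.mulVec_mulVec, Matrix.dotProduct_mulVec,
      Matrix.vecMul_transpose]
    simp [dotProduct, sq]
  have hBB : Bᵀ * B = a • 1 + A := by rw [hA]; abel
  have hsq : ‖B‖ ^ 2 = ‖Bᵀ * B‖ := by
    have := Matrix.l2_opNorm_conjTranspose_mul_self B
    rw [Matrix.conjTranspose_eq_transpose_of_trivial] at this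
    rw [this, sq]
  rw [hsq, hBB]
  refine (norm_add_le _ _).trans (add_le_add ?_ hbound)
  rw [norm_smul, Real.norm_of_nonneg ha]
  refine mul_le_of_le_one_right ha ?_
  have := Matrix.l2_opNorm_diagonal (𝕜 := ℝ) (fun _ : Fin r => (1 : ℝ))
  rw [Matrix.diagonal_one] at this
  rw [this]
  exact (pi_norm_le_iff_of_nonneg zero_le_one).2 fun _ => by simp

/-! ### Exponential moments of a centred squared Gaussian. -/

theorem integral_exp_sq_sub_var_gaussianReal {v : ℝ≥0} (hv : v ≠ 0) {s : ℝ}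
    (hs : |s * v| ≤ 1 / 4) :
    ∫ x, Real.exp (s * (x ^ 2 - v)) ∂(ProbabilityTheory.gaussianReal 0 v) =
      Real.exp (-(s * v) - Real.log (1 - 2 * (s * v)) / 2) := by
  have hv0 : (0 : ℝ) < v := by positivity
  have hpos : 0 < 1 - 2 * (s * v) := by linarith [(abs_le.1 hs).2]
  rw [ProbabilityTheory.integral_gaussianReal_eq_integral_smul hv]
  have hfun : ∀ x : ℝ, ProbabilityTheory.gaussianPDFReal 0 v x • Real.exp (s * (x ^ 2 - v)) =
      ((√(2 * Real.pi * v))⁻¹ * Real.exp (-(s * v))) *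
        Real.exp (-((1 - 2 * (s * v)) / (2 * v)) * x ^ 2) := by
    intro x
    rw [ProbabilityTheory.gaussianPDFReal, smul_eq_mul, mul_assoc _ (Real.exp _), mul_assoc _ (Real.exp _),
      ← Real.exp_add, ← Real.exp_add]
    congr 2
    field_simp
    ring
  simp_rw [hfun]
  rw [MeasureTheory.integral_const_mul, integral_gaussian]
  have hsqrt : √(Real.pi / ((1 - 2 * (s * v)) / (2 * v))) =
      √(2 * Real.pi * v) * (√(1 - 2 * (s * v)))⁻¹ := by
    rw [← Real.sqrt_inv, ← Real.sqrt_mul (by positivity)]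
    congr 1
    field_simp
  have hne : √(2 * Real.pi * v) ≠ 0 := by positivity
  rw [hsqrt, Real.exp_sub, Real.exp_half, Real.exp_log hpos]
  field_simp

theorem integrable_exp_sq_sub_var_gaussianReal {v : ℝ≥0} (hv : v ≠ 0) {s : ℝ}
    (hs : |s * v| ≤ 1 / 4) :
    MeasureTheory.Integrable (fun x : ℝ => Real.exp (s * (x ^ 2 - v)))
      (ProbabilityTheory.gaussianReal 0 v) := by
  refine MeasureTheory.Integrable.of_integral_ne_zero ?_
  rw [integral_exp_sq_sub_var_gaussianReal hv hs]
  exact Real.exp_ne_zero _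

/-- Centring cancels the linear term of `-log (1 - 2t) / 2` at `t = s v`, leaving a quadratic
remainder. -/
theorem mgf_sq_sub_var_gaussianReal_le {v : ℝ≥0} (hv : v ≠ 0) {s : ℝ}
    (hs : |s * v| ≤ 1 / 4) :
    ProbabilityTheory.mgf (fun x : ℝ => x ^ 2 - v) (ProbabilityTheory.gaussianReal 0 v) s ≤
      Real.exp (4 * (s * v) ^ 2) := by
  rw [ProbabilityTheory.mgf, integral_exp_sq_sub_var_gaussianReal hv hs, Real.exp_le_exp]
  set t := s * (v : ℝ)
  have habs : |2 * t| ≤ 1 / 2 := by rw [abs_mul, abs_two]; linarith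
  have h := Real.abs_log_sub_add_sum_range_le (x := 2 * t) (by linarith) 1
  simp only [Finset.range_one, Finset.sum_singleton, zero_add, pow_one, Nat.cast_zero, div_one] at h
  have h2 : |2 * t| ^ (1 + 1) / (1 - |2 * t|) ≤ 8 * t ^ 2 := by
    rw [div_le_iff₀ (by linarith), one_add_one_eq_two, sq_abs]
    nlinarith [sq_nonneg t]
  have h3 := (abs_le.1 (h.trans h2)).1
  linarith

open ProbabilityTheory MeasureTheory

/-! ### Moments and laws of the random matrix and its images. -/

section Rows

variable {Ω : Type*} [MeasurableSpace Ω] {μ : Measure Ω}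
  {d r : ℕ} {v : ℝ≥0} {B : Ω → Matrix (Fin d) (Fin r) ℝ}

theorem covariance_entries
    (hB : ∀ i j, HasLaw (fun ω => B ω i j) (gaussianReal 0 v) μ)
    (hind : iIndepFun (fun (p : Fin d × Fin r) (ω : Ω) => B ω p.1 p.2) μ) (p q : Fin d × Fin r) :
    cov[fun ω => B ω p.1 p.2, fun ω => B ω q.1 q.2; μ] = if p = q then (v : ℝ) else 0 := by
  split_ifs with h
  · subst h
    rw [covariance_self (hB _ _).aemeasurable, (hB _ _).variance_eq, variance_id_gaussianReal]
  · exact (hind.indepFun h).covariance_eq_zero (hB _ _).hasGaussianLaw.memLp_two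
      (hB _ _).hasGaussianLaw.memLp_two

theorem integral_entry (hB : ∀ i j, HasLaw (fun ω => B ω i j) (gaussianReal 0 v) μ)
    (i : Fin d) (j : Fin r) : ∫ ω, B ω i j ∂μ = 0 := by
  rw [(hB i j).integral_eq, integral_id_gaussianReal]

theorem integral_entry_mul_entry
    (hB : ∀ i j, HasLaw (fun ω => B ω i j) (gaussianReal 0 v) μ)
    (hind : iIndepFun (fun (p : Fin d × Fin r) (ω : Ω) => B ω p.1 p.2) μ) (p q : Fin d × Fin r) :
    ∫ ω, B ω p.1 p.2 * B ω q.1 q.2 ∂μ = if p = q then (v : ℝ) else 0 := by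
  have := hind.isProbabilityMeasure
  rw [← covariance_entries hB hind, covariance_eq_sub (hB _ _).hasGaussianLaw.memLp_two
      (hB _ _).hasGaussianLaw.memLp_two, integral_entry hB, zero_mul, sub_zero]
  rfl

theorem covariance_mulVec
    (hB : ∀ i j, HasLaw (fun ω => B ω i j) (gaussianReal 0 v) μ)
    (hind : iIndepFun (fun (p : Fin d × Fin r) (ω : Ω) => B ω p.1 p.2) μ)
    (x : Fin r → ℝ) (i k : Fin d) :
    cov[fun ω => (B ω *ᵥ x) i, fun ω => (B ω *ᵥ x) k; μ] =
      if i = k then (v : ℝ) * ∑ j, x j ^ 2 else 0 := by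
  have := hind.isProbabilityMeasure
  have hL : ∀ i j, MemLp (fun ω => B ω i j * x j) 2 μ := fun i j =>
    (hB i j).hasGaussianLaw.memLp_two.mul_const _
  simp only [Matrix.mulVec, dotProduct]
  rw [covariance_fun_sum_fun_sum (hL i) (hL k)]
  have : ∀ j l, cov[fun ω => B ω i j * x j, fun ω => B ω k l * x l; μ] =
      if (i, j) = (k, l) then (v : ℝ) * (x j * x l) else 0 := by
    intro j l
    rw [covariance_mul_const_left, covariance_mul_const_right,
      covariance_entries hB hind (i, j) (k, l)]
    split_ifs <;> ring
  simp_rw [this, Prod.mk.injEq]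
  by_cases hik : i = k
  · simp [hik, Finset.mul_sum, sq]
  · simp [hik]

theorem hasGaussianLaw_mulVec
    (hB : ∀ i j, HasLaw (fun ω => B ω i j) (gaussianReal 0 v) μ)
    (hind : iIndepFun (fun (p : Fin d × Fin r) (ω : Ω) => B ω p.1 p.2) μ) (x : Fin r → ℝ) :
    HasGaussianLaw (fun ω i => (B ω *ᵥ x) i) μ := by
  have hG := iIndepFun.hasGaussianLaw (fun p : Fin d × Fin r => (hB p.1 p.2).hasGaussianLaw) hind
  let T : (Fin d × Fin r → ℝ) →ₗ[ℝ] (Fin d → ℝ) :=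
    { toFun := fun b i => ∑ j, b (i, j) * x j
      map_add' := fun b c => by ext i; simp [add_mul, Finset.sum_add_distrib]
      map_smul' := fun a b => by ext i; simp [Finset.mul_sum, mul_assoc] }
  exact hG.map_fun T.toContinuousLinearMap

/-- The coordinates are jointly Gaussian, so being uncorrelated suffices. -/
theorem iIndepFun_mulVec
    (hB : ∀ i j, HasLaw (fun ω => B ω i j) (gaussianReal 0 v) μ)
    (hind : iIndepFun (fun (p : Fin d × Fin r) (ω : Ω) => B ω p.1 p.2) μ) (x : Fin r → ℝ) :
    iIndepFun (fun (i : Fin d) ω => (B ω *ᵥ x) i) μ :=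
  (hasGaussianLaw_mulVec hB hind x).iIndepFun_of_covariance_eq_zero fun i k hik => by
    rw [covariance_mulVec hB hind, if_neg hik]

theorem hasLaw_mulVec
    (hB : ∀ i j, HasLaw (fun ω => B ω i j) (gaussianReal 0 v) μ)
    (hind : iIndepFun (fun (p : Fin d × Fin r) (ω : Ω) => B ω p.1 p.2) μ) {x : Fin r → ℝ}
    (hx : ∑ j, x j ^ 2 = 1) (i : Fin d) :
    HasLaw (fun ω => (B ω *ᵥ x) i) (gaussianReal 0 v) μ := by
  have hG := (hasGaussianLaw_mulVec hB hind x).eval i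
  refine ⟨hG.aemeasurable, ?_⟩
  rw [hG.map_eq_gaussianReal]
  congr 1
  · simp only [Matrix.mulVec, dotProduct]
    rw [integral_finsetSum _ fun j _ => (hB i j).hasGaussianLaw.integrable.mul_const _]
    simp [integral_mul_const, integral_entry hB]
  · rw [← covariance_self hG.aemeasurable, covariance_mulVec hB hind, if_pos rfl, hx, mul_one,
      Real.toNNReal_coe]

/-- The exponential moments of `‖B x‖ ^ 2 - d * v` for a unit vector `x`. -/
theorem integrable_exp_and_mgf_le_mulVec
    (hB : ∀ i j, HasLaw (fun ω => B ω i j) (gaussianReal 0 v) μ)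
    (hind : iIndepFun (fun (p : Fin d × Fin r) (ω : Ω) => B ω p.1 p.2) μ) {x : Fin r → ℝ}
    (hx : ∑ j, x j ^ 2 = 1) (hv : v ≠ 0) {s : ℝ} (hs : |s * v| ≤ 1 / 4) :
    Integrable (fun ω => Real.exp (s * (∑ i, (B ω *ᵥ x) i ^ 2 - d * v))) μ ∧
      ∫ ω, Real.exp (s * (∑ i, (B ω *ᵥ x) i ^ 2 - d * v)) ∂μ ≤
        Real.exp (4 * d * (s * v) ^ 2) := by
  have hlaw := hasLaw_mulVec hB hind hx
  let Z : Fin d → Ω → ℝ := fun i ω => (B ω *ᵥ x) i ^ 2 - v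
  have hZm : ∀ i, AEMeasurable (Z i) μ := fun i => ((hlaw i).aemeasurable.pow_const 2).sub_const _
  have hZind : iIndepFun Z μ :=
    (iIndepFun_mulVec hB hind x).comp (fun _ y => y ^ 2 - (v : ℝ)) fun _ => by fun_prop
  have hmgf : ∀ i, mgf (Z i) μ s =
      mgf (fun y : ℝ => y ^ 2 - v) (gaussianReal 0 v) s := fun i =>
    (hlaw i).integral_comp (f := fun y => Real.exp (s * (y ^ 2 - v))) (by fun_prop)
  have hsum : (∑ i, Z i) = fun ω => ∑ i, (B ω *ᵥ x) i ^ 2 - d * v := by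
    ext ω; simp [Z, Finset.sum_sub_distrib]
  have hprod := hZind.mgf_sum₀ (t := s) hZm Finset.univ
  simp_rw [hmgf] at hprod
  rw [Finset.prod_const, Finset.card_univ, Fintype.card_fin, hsum] at hprod
  have hpos : 0 < mgf (fun y : ℝ => y ^ 2 - v) (gaussianReal 0 v) s :=
    mgf_pos (integrable_exp_sq_sub_var_gaussianReal hv hs)
  constructor
  · refine Integrable.of_integral_ne_zero ?_
    exact (hprod.trans_gt (pow_pos hpos d)).ne'
  · calc _ = _ := hprod
      _ ≤ Real.exp (4 * (s * v) ^ 2) ^ d :=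
        pow_le_pow_left₀ hpos.le (mgf_sq_sub_var_gaussianReal_le hv hs) d
      _ = _ := by rw [← Real.exp_nat_mul]; congr 1; ring

theorem integrable_mul_transpose_mulVec
    (hB : ∀ i j, HasLaw (fun ω => B ω i j) (gaussianReal 0 v) μ) (w : EuclideanSpace ℝ (Fin d)) :
    Integrable (fun ω => WithLp.toLp 2 ((B ω * (B ω)ᵀ) *ᵥ w.ofLp)) μ := by
  rw [← (PiLp.continuousLinearEquiv 2 ℝ (fun _ : Fin d => ℝ)).integrable_comp_iff]
  refine Integrable.of_eval fun i => ?_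
  simp only [PiLp.continuousLinearEquiv_apply, Matrix.mulVec, dotProduct, Matrix.mul_apply,
    Matrix.transpose_apply]
  exact integrable_finsetSum _ fun k _ => (integrable_finsetSum _ fun j _ =>
    (hB i j).hasGaussianLaw.memLp_two.integrable_mul
      (hB k j).hasGaussianLaw.memLp_two).mul_const _

theorem integral_mul_transpose_mulVec
    (hB : ∀ i j, HasLaw (fun ω => B ω i j) (gaussianReal 0 v) μ)
    (hind : iIndepFun (fun (p : Fin d × Fin r) (ω : Ω) => B ω p.1 p.2) μ)
    (w : EuclideanSpace ℝ (Fin d)) :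
    ∫ ω, WithLp.toLp 2 ((B ω * (B ω)ᵀ) *ᵥ w.ofLp) ∂μ = ((r : ℝ) * v) • w := by
  ext i
  have h := (EuclideanSpace.proj (𝕜 := ℝ) i).integral_comp_comm
    (integrable_mul_transpose_mulVec hB w)
  refine h.symm.trans ?_
  have hint : ∀ k j, Integrable (fun ω => B ω i j * B ω k j) μ := fun k j =>
    (hB i j).hasGaussianLaw.memLp_two.integrable_mul (hB k j).hasGaussianLaw.memLp_two
  simp only [PiLp.proj_apply, Matrix.mulVec, dotProduct, Matrix.mul_apply, Matrix.transpose_apply]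
  rw [integral_finsetSum _ fun k _ => (integrable_finsetSum _ fun j _ => hint k j).mul_const _]
  simp_rw [integral_mul_const]
  have : ∀ k, ∫ ω, ∑ j, B ω i j * B ω k j ∂μ = if i = k then (r : ℝ) * v else 0 := by
    intro k
    rw [integral_finsetSum _ fun j _ => hint k j]
    have := fun j => integral_entry_mul_entry hB hind (i, j) (k, j)
    simp only [Prod.mk.injEq, and_true] at this
    simp_rw [this]
    split_ifs <;> simp
  simp_rw [this]
  simp

theorem aestronglyMeasurable_l2_opNorm_sq (hB : ∀ i j, AEMeasurable (fun ω => B ω i j) μ) :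
    AEStronglyMeasurable (fun ω => ‖B ω‖ ^ 2) μ := by
  let T : (Fin d → Fin r → ℝ) →ₗ[ℝ] Matrix (Fin d) (Fin r) ℝ :=
    { toFun := fun b => Matrix.of b
      map_add' := fun _ _ => rfl
      map_smul' := fun _ _ => rfl }
  have hT : Continuous fun b => ‖T b‖ ^ 2 :=
    (T.continuous_of_finiteDimensional).norm.pow 2
  exact hT.comp_aestronglyMeasurable (f := fun ω i j => B ω i j)
    (aemeasurable_pi_lambda _ fun i => aemeasurable_pi_lambda _ (hB i)).aestronglyMeasurable

end Rows

/-! ### Expected squared operator norm. -/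

section OperatorNorm

variable {Ω : Type*} [MeasurableSpace Ω] {μ : Measure Ω} [IsProbabilityMeasure μ]
  {d r : ℕ} {v : ℝ≥0} {B : Ω → Matrix (Fin d) (Fin r) ℝ}

/-- If `exp (s * f)` is bounded by an integrable function with integral at most `K`, the
expectation of `f` is bounded by `log K / s`. -/
theorem integrable_and_integral_le_of_le_add_mul_log {f g S : Ω → ℝ} {a b s K : ℝ}
    (hf : AEStronglyMeasurable f μ) (hf0 : ∀ ω, 0 ≤ f ω) (hb : 0 ≤ b) (hs : 0 < s) (hK : 0 < K)
    (hfg : ∀ ω, f ω ≤ a + b * g ω) (hgS : ∀ ω, Real.exp (s * g ω) ≤ S ω)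
    (hS : Integrable S μ) (hSK : ∫ ω, S ω ∂μ ≤ K) :
    Integrable f μ ∧ ∫ ω, f ω ∂μ ≤ a + b * (Real.log K / s) := by
  -- The tangent line of `log` at `K` replaces Jensen's inequality and also supplies an integrable
  -- majorant.
  have hg : ∀ ω, g ω ≤ (Real.log K - 1 + S ω / K) / s := by
    intro ω
    rw [le_div_iff₀ hs]
    have h1 := Real.add_one_le_exp (s * g ω - Real.log K)
    rw [Real.exp_sub, Real.exp_log hK] at h1
    have h2 := div_le_div_of_nonneg_right (hgS ω) hK.le
    linarith
  have hbound : ∀ ω, f ω ≤ a + b * ((Real.log K - 1 + S ω / K) / s) := fun ω =>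
    (hfg ω).trans (by gcongr; exact hg ω)
  have hint1 : Integrable (fun ω => Real.log K - 1 + S ω / K) μ :=
    (integrable_const _).add (hS.div_const K)
  have hint : Integrable (fun ω => a + b * ((Real.log K - 1 + S ω / K) / s)) μ :=
    (integrable_const _).add ((hint1.div_const s).const_mul b)
  have hfint : Integrable f μ := hint.mono' hf <| .of_forall fun ω => by
    rw [Real.norm_of_nonneg (hf0 ω)]; exact hbound ω
  refine ⟨hfint, (integral_mono hfint hint hbound).trans ?_⟩
  rw [integral_add (integrable_const _) ((hint1.div_const s).const_mul b),
    integral_const_mul, integral_div,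
    integral_add (integrable_const _) (hS.div_const K), integral_div]
  simp only [integral_const, probReal_univ, one_smul]
  have := (div_le_one hK).2 hSK
  gcongr
  linarith

theorem integrable_and_integral_l2_opNorm_sq_le
    (hB : ∀ i j, HasLaw (fun ω => B ω i j) (gaussianReal 0 v) μ)
    (hind : iIndepFun (fun (p : Fin d × Fin r) (ω : Ω) => B ω p.1 p.2) μ)
    (hr : 0 < r) (hv : v ≠ 0) {t : ℝ} (ht0 : 0 < t) (ht : t ≤ 1 / 4) :
    Integrable (fun ω => ‖B ω‖ ^ 2) μ ∧
      ∫ ω, ‖B ω‖ ^ 2 ∂μ ≤ d * v + 32 * ((3 * r + 4 * d * t ^ 2) / (t / v)) := by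
  have hv0 : (0 : ℝ) < v := by positivity
  obtain ⟨N, hNcard, hN1, hN⟩ := exists_half_net_sphere (EuclideanSpace ℝ (Fin r))
  rw [finrank_euclideanSpace_fin] at hNcard
  have hNne : N.Nonempty := by
    obtain ⟨y, hy, -⟩ := hN (EuclideanSpace.single ⟨0, hr⟩ 1) (by simp)
    exact ⟨y, hy⟩
  set s : ℝ := t / v with hs
  have hs0 : 0 < s := by positivity
  have hsv : s * v = t := by rw [hs]; field_simp
  let q : EuclideanSpace ℝ (Fin r) → Ω → ℝ := fun y ω => ∑ i, (B ω *ᵥ y.ofLp) i ^ 2 - d * v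
  have hunit : ∀ y ∈ N, ∑ j, y.ofLp j ^ 2 = 1 := fun y hy => by
    rw [← EuclideanSpace.real_norm_sq_eq, hN1 y hy, one_pow]
  have hpos : ∀ y ∈ N, _ := fun y hy => integrable_exp_and_mgf_le_mulVec hB hind (hunit y hy) hv
    (s := s) (by rw [hsv, abs_of_pos ht0]; exact ht)
  have hneg : ∀ y ∈ N, _ := fun y hy => integrable_exp_and_mgf_le_mulVec hB hind (hunit y hy) hv
    (s := -s) (by rw [neg_mul, hsv, abs_neg, abs_of_pos ht0]; exact ht)
  rw [neg_mul, hsv, neg_sq] at hneg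
  rw [hsv] at hpos
  -- Summing over the net and both signs dominates the exponential of the maximal absolute
  -- deviation.
  let S : Ω → ℝ := fun ω => ∑ y ∈ N, (Real.exp (s * q y ω) + Real.exp (-s * q y ω))
  let K : ℝ := 5 ^ r * (2 * Real.exp (4 * d * t ^ 2))
  have hyint : ∀ y ∈ N, Integrable
      (fun ω => Real.exp (s * q y ω) + Real.exp (-s * q y ω)) μ := fun y hy =>
    (hpos y hy).1.add (hneg y hy).1
  have hSint : Integrable S μ := integrable_finsetSum _ hyint
  have hSK : ∫ ω, S ω ∂μ ≤ K := by
    rw [integral_finsetSum _ hyint]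
    calc _ ≤ ∑ y ∈ N, 2 * Real.exp (4 * d * t ^ 2) := by
          refine Finset.sum_le_sum fun y hy => ?_
          rw [integral_add (hpos y hy).1 (hneg y hy).1, two_mul]
          exact add_le_add (hpos y hy).2 (hneg y hy).2
      _ = N.card * (2 * Real.exp (4 * d * t ^ 2)) := by rw [Finset.sum_const, nsmul_eq_mul]
      _ ≤ K := by
          refine mul_le_mul_of_nonneg_right ?_ (by positivity)
          exact_mod_cast hNcard
  let g : Ω → ℝ := fun ω => N.sup' hNne fun y => |q y ω|
  have hqg : ∀ ω, ∀ y ∈ N, |q y ω| ≤ g ω := fun ω y hy =>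
    Finset.le_sup' (fun y => |q y ω|) hy
  have hg0 : ∀ ω, 0 ≤ g ω := fun ω =>
    hNne.elim fun y hy => (abs_nonneg _).trans (hqg ω y hy)
  have hgS : ∀ ω, Real.exp (s * g ω) ≤ S ω := by
    intro ω
    obtain ⟨y, hy, hgy⟩ := Finset.exists_mem_eq_sup' hNne fun y => |q y ω|
    have h1 : Real.exp (s * |q y ω|) ≤ Real.exp (s * q y ω) + Real.exp (-s * q y ω) := by
      rcases abs_choice (q y ω) with h | h <;> rw [h]
      · exact le_add_of_nonneg_right (Real.exp_nonneg _)
      · rw [mul_neg, ← neg_mul]; exact le_add_of_nonneg_left (Real.exp_nonneg _)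
    change Real.exp (s * N.sup' hNne fun y => |q y ω|) ≤ _
    rw [hgy]
    exact h1.trans (Finset.single_le_sum
      (f := fun y => Real.exp (s * q y ω) + Real.exp (-s * q y ω)) (fun _ _ => by positivity) hy)
  obtain ⟨hint, hle⟩ := integrable_and_integral_le_of_le_add_mul_log (μ := μ)
    (aestronglyMeasurable_l2_opNorm_sq fun i j => (hB i j).aemeasurable) (fun _ => sq_nonneg _)
    (by norm_num : (0 : ℝ) ≤ 32) hs0 (by positivity : 0 < K)
    (fun ω => (B ω).l2_opNorm_sq_le_of_half_net N hN1 hN (by positivity) (hg0 ω) (hqg ω))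
    hgS hSint hSK
  refine ⟨hint, hle.trans ?_⟩
  have hlog : Real.log K ≤ 3 * r + 4 * d * t ^ 2 := by
    have h1 : (1 : ℝ) ≤ r := by exact_mod_cast hr
    -- Since `r ≥ 1`, the factor `2` is absorbed into `10 ^ r`, and `10 ≤ e ^ 3`.
    have h10 : (5 : ℝ) ^ r * 2 ≤ Real.exp 1 ^ (3 * r) := by
      have hexp : (10 : ℝ) ≤ Real.exp 1 ^ 3 := calc
        (10 : ℝ) ≤ 2.7 ^ 3 := by norm_num
        _ ≤ _ := by gcongr; linarith [Real.exp_one_gt_d9]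
      have h2 : (2 : ℝ) ≤ 2 ^ r := by simpa using pow_le_pow_right₀ one_le_two hr
      calc (5 : ℝ) ^ r * 2 ≤ 5 ^ r * 2 ^ r := by gcongr
        _ = 10 ^ r := by rw [← mul_pow]; norm_num
        _ ≤ (Real.exp 1 ^ 3) ^ r := by gcongr
        _ = _ := by rw [pow_mul]
    have hKle : K ≤ Real.exp (3 * r + 4 * d * t ^ 2) := by
      rw [Real.exp_add, show (3 * r : ℝ) = ((3 * r : ℕ) : ℝ) * 1 by push_cast; ring,
        Real.exp_nat_mul]
      calc K = (5 ^ r * 2) * Real.exp (4 * d * t ^ 2) := by simp only [K]; ring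
        _ ≤ _ := by gcongr
    exact (Real.log_le_iff_le_exp (by positivity)).2 hKle
  gcongr

end OperatorNorm

theorem mainTheorem3 :
    ∃ C : ℝ, 0 < C ∧
      ∀ (d r : ℕ), 0 < r → r < d →
      ∀ (Ω : Type*) [MeasurableSpace Ω] (μ : MeasureTheory.Measure Ω)
        [MeasureTheory.IsProbabilityMeasure μ] (B : Ω → Matrix (Fin d) (Fin r) ℝ),
        (∀ i j, ProbabilityTheory.HasLaw (fun ω => B ω i j)
          (ProbabilityTheory.gaussianReal 0 (1 / (r : ℝ≥0))) μ) →
        ProbabilityTheory.iIndepFun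
          (fun (p : Fin d × Fin r) (ω : Ω) => B ω p.1 p.2) μ →
        (MeasureTheory.Integrable (fun ω => ‖B ω‖ ^ 2) μ ∧
          ∫ ω, ‖B ω‖ ^ 2 ∂μ ≤
            ((d : ℝ) / (r : ℝ)) * (1 + C * Real.sqrt ((r : ℝ) / (d : ℝ)))) ∧
        (∀ v : EuclideanSpace ℝ (Fin d), ‖v‖ = 1 →
          MeasureTheory.Integrable
            (fun ω => WithLp.toLp 2 ((B ω * (B ω)ᵀ) *ᵥ v.ofLp)) μ ∧
          ∫ ω, WithLp.toLp 2 ((B ω * (B ω)ᵀ) *ᵥ v.ofLp) ∂μ = v) := by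
  -- With `t = u/4` and `r = u ^ 2 d`, the error is `32 * (3 + 1/4) * 4 / u = 416 / u`, which is
  -- `(d/r) * 416 u`.
  refine ⟨416, by norm_num, ?_⟩
  intro d r hr hrd Ω _ μ _ B hB hind
  have hr0 : (0 : ℝ) < r := by exact_mod_cast hr
  have hd0 : (0 : ℝ) < d := by exact_mod_cast hr.trans hrd
  have hv : (1 / (r : ℝ≥0)) ≠ 0 := by
    have : (r : ℝ≥0) ≠ 0 := by exact_mod_cast hr.ne'
    positivity
  have hvr : ((1 / (r : ℝ≥0) : ℝ≥0) : ℝ) = 1 / r := by push_cast; rfl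
  refine ⟨?_, fun w _ => ⟨integrable_mul_transpose_mulVec hB w, ?_⟩⟩
  · set u : ℝ := √((r : ℝ) / d) with hu
    have hu0 : 0 < u := by positivity
    have hu1 : u ≤ 1 := by
      rw [hu, Real.sqrt_le_one, div_le_one hd0]
      exact_mod_cast hrd.le
    have husq : (r : ℝ) = u ^ 2 * d := by
      rw [hu, Real.sq_sqrt (by positivity)]; field_simp
    obtain ⟨hint, hle⟩ := integrable_and_integral_l2_opNorm_sq_le hB hind hr hv
      (t := u / 4) (by positivity) (by linarith)
    refine ⟨hint, hle.trans (le_of_eq ?_)⟩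
    rw [hvr, husq]
    field_simp
    ring
  · rw [integral_mul_transpose_mulVec hB hind, hvr, mul_one_div_cancel hr0.ne', one_smul]
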